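/- Let $H=\{w\in\mathbf C : \operatorname{Im} w>0\}$ be the upper half plane with hyperbolic distance $d$, and let $\Gamma\subset \mathrm{PSL}(2,\mathbf R)$ be a discrete subgroup (Fuchsian group) containing the parabolic element $z\mapsto z+1$; this covers every Fuchsian group uniformizing a punctured hyperbolic surface, normalized so that the puncture corresponds to $z\mapsto z+1$. Let $\Gamma_\infty$ be the cyclic group generated by $z\mapsto z+1$. For $z\in H$ and $[\delta]\in\Gamma_\infty\backslash\Gamma$ let $\hat\delta$ be the unique representative of $[\delta]$ with $-\frac12\le\operatorname{Re}\hat\delta z<\frac12$. Put $h=\{w\in H : -\frac12\le \operatorname{Re}w<\frac12,\ \operatorname{Im}w=1\}$ and $$\Pi(h,z,t)=\sharp\{[\delta]\in\Gamma_\infty\backslash\Gamma : d(h,\hat\delta z)\le t\},\qquad \Pi(z,t)=\sharp\{[\delta]\in\Gamma_\infty\backslash\Gamma : d(i,\hat\delta z)\le t\},$$ $$E(z,s)=\sum_{[\delta]\in\Gamma_\infty\backslash\Gamma}(\operatorname{Im}\delta z)^s .$$ **Proposition.** Let $s>1$ be real and let $z\in H$ with $\operatorname{Im}z<1$ be not $\Gamma$-equivalent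 to any point of $\{w\in H : \operatorname{Im}w>1\}$. Then $\Pi(h,z,t)$ and $\Pi(z,t)$ are finite for all real $t$, $$\Pi(z,t)\le\Pi(h,z,t)\le\Pi(z,t+1)\qquad\text{for all real } t,$$ the series $E(z,s)$ and the integrals below converge absolutely, $E(z,s)$ is real, $$E(z,s)=s\int_0^\infty e^{-st}\,\Pi(h,z,t)\,dt,$$ and $$s\int_0^\infty e^{-st}\,\Pi(z,t)\,dt\ \le\ E(z,s)\ \le\ s\int_0^\infty e^{-st}\,\Pi(z,t+1)\,dt .$$ -/

import Mathlib

open scoped UpperHalfPlane MatrixGroups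

noncomputable section

namespace OrbitCount

/-- The action of `PSL(2, ℝ)` on the upper half plane by Möbius transformations, restricted from
Mathlib's action of `PGL(2, ℝ)`. -/
instance pslAction : MulAction PSL(2, ℝ) ℍ :=
  MulAction.compHom ℍ (Matrix.ProjectiveSpecialLinearGroup.toPGL (n := Fin 2) (R := ℝ))

theorem mk_smul (g : SL(2, ℝ)) (z : ℍ) : (QuotientGroup.mk g : PSL(2, ℝ)) • z = g • z := rfl

/-- The matrix `(1 1; 0 1)`. -/
def shiftMatrix : SL(2, ℝ) := ⟨!![1, 1; 0, 1], by simp [Matrix.det_fin_two]⟩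

/-- The parabolic transformation `z ↦ z + 1`, as an element of `PSL(2, ℝ)`. -/
def shift : PSL(2, ℝ) := QuotientGroup.mk shiftMatrix

theorem shift_smul (z : ℍ) : shift • z = (1 : ℝ) +ᵥ z := by
  rw [shift, mk_smul]
  ext1
  rw [UpperHalfPlane.coe_specialLinearGroup_apply, UpperHalfPlane.coe_vadd]
  simp [shiftMatrix, add_comm]

theorem shift_zpow_smul (n : ℤ) (z : ℍ) : shift ^ n • z = (n : ℝ) +ᵥ z := by
  induction n with
  | zero => simp
  | succ n ih =>
    rw [add_comm, zpow_one_add, mul_smul, ih, shift_smul, vadd_vadd]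
    push_cast
    rfl
  | pred n ih =>
    rw [← smul_left_cancel_iff shift, ← mul_smul, ← zpow_one_add, add_sub_cancel, ih, shift_smul,
      vadd_vadd]
    push_cast
    ring_nf

variable (Γ : Subgroup PSL(2, ℝ)) (hT : shift ∈ Γ)

/-- `Γ_∞`, the cyclic subgroup of `Γ` generated by `z ↦ z + 1`. -/
def cuspGroup : Subgroup Γ := Subgroup.zpowers (⟨shift, hT⟩ : Γ)

/-- The set `Γ_∞ \ Γ` of classes `[δ] = Γ_∞ δ`. -/
def CuspCosets : Type := Quotient (QuotientGroup.rightRel (cuspGroup Γ hT))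

variable {Γ}

/-- The class `[δ] = Γ_∞ δ` of `δ ∈ Γ`. -/
def toCoset (δ : Γ) : CuspCosets Γ hT := Quotient.mk _ δ

theorem toCoset_eq_iff (δ ε : Γ) :
    toCoset hT δ = toCoset hT ε ↔ ∃ n : ℤ, (ε : PSL(2, ℝ)) = shift ^ n * δ := by
  unfold toCoset CuspCosets
  rw [Quotient.eq, QuotientGroup.rightRel_apply, cuspGroup, Subgroup.mem_zpowers_iff]
  refine exists_congr fun n => ?_
  rw [Subtype.ext_iff, eq_comm]
  push_cast
  rw [mul_inv_eq_iff_eq_mul]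

/-- `δ` is a representative of the class `q` with `-1/2 ≤ Re (δ z) < 1/2`. -/
def IsCanonicalRep (z : ℍ) (q : CuspCosets Γ hT) (δ : Γ) : Prop :=
  toCoset hT δ = q ∧ -(1 / 2) ≤ (δ • z).re ∧ (δ • z).re < 1 / 2

theorem existsUnique_isCanonicalRep (z : ℍ) (q : CuspCosets Γ hT) :
    ∃! δ : Γ, IsCanonicalRep hT z q δ := by
  obtain ⟨δ, rfl⟩ : ∃ δ, toCoset hT δ = q := Quotient.exists_rep q
  have key : ∀ (n : ℤ) (ε : Γ), (ε : PSL(2, ℝ)) = shift ^ n * δ →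
      (ε • z).re = n + (δ • z).re := by
    intro n ε h
    rw [Subgroup.smul_def, h, mul_smul, shift_zpow_smul, UpperHalfPlane.vadd_re,
      Subgroup.smul_def]
  have hfl := Int.floor_le ((δ • z).re + 1 / 2)
  have hlt := Int.lt_floor_add_one ((δ • z).re + 1 / 2)
  refine ⟨(⟨shift, hT⟩ : Γ) ^ (-⌊(δ • z).re + 1 / 2⌋) * δ, ⟨?_, ?_⟩, ?_⟩
  · rw [eq_comm, toCoset_eq_iff]
    exact ⟨_, rfl⟩
  · rw [key (-⌊(δ • z).re + 1 / 2⌋) _ rfl]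
    push_cast
    constructor <;> linarith
  · rintro ε ⟨h1, h2, h3⟩
    obtain ⟨n, hn⟩ := (toCoset_eq_iff hT δ ε).1 h1.symm
    rw [key n ε hn] at h2 h3
    have : n = -⌊(δ • z).re + 1 / 2⌋ := by
      rw [eq_neg_iff_add_eq_zero, add_comm, ← eq_neg_iff_add_eq_zero, Int.floor_eq_iff]
      push_cast
      constructor <;> linarith
    subst this
    exact Subtype.ext hn

/-- The canonical representative of the class `q` with respect to `z`. -/
def canonicalRep (z : ℍ) (q : CuspCosets Γ hT) : Γ :=
  (existsUnique_isCanonicalRep hT z q).choose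

theorem canonicalRep_spec (z : ℍ) (q : CuspCosets Γ hT) :
    IsCanonicalRep hT z q (canonicalRep hT z q) :=
  (existsUnique_isCanonicalRep hT z q).choose_spec.1

/-- `Im (δ z)`, which depends only on the class `[δ]`. -/
def cosetIm (z : ℍ) : CuspCosets Γ hT → ℝ :=
  Quotient.lift (fun δ : Γ => (δ • z).im) (by
    intro δ ε h
    obtain ⟨n, hn⟩ := (toCoset_eq_iff hT δ ε).1 (Quotient.sound h)
    change (δ • z).im = (ε • z).im
    rw [Subgroup.smul_def ε, hn, mul_smul, shift_zpow_smul, UpperHalfPlane.vadd_im,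
      Subgroup.smul_def])

theorem cosetIm_toCoset (z : ℍ) (δ : Γ) : cosetIm hT z (toCoset hT δ) = (δ • z).im := rfl

/-- The Eisenstein series `E(z, s) = ∑_{[δ] ∈ Γ_∞ \ Γ} (Im δz)^s`. -/
def eisenstein (z : ℍ) (s : ℂ) : ℂ :=
  ∑' q : CuspCosets Γ hT, (cosetIm hT z q : ℂ) ^ s

/-- The horocyclic segment `h = {w ∈ ℍ | -1/2 ≤ Re w < 1/2, Im w = 1}`. -/
def horoSegment : Set ℍ := {w | -(1 / 2) ≤ w.re ∧ w.re < 1 / 2 ∧ w.im = 1}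

/-- The classes `[δ]` with `d(h, δ̂ z) ≤ t`, where `δ̂` is the canonical representative and `d` is
the hyperbolic distance (from a set to a point: the infimum of the distances). -/
def horoClasses (z : ℍ) (t : ℝ) : Set (CuspCosets Γ hT) :=
  {q | Metric.infDist (canonicalRep hT z q • z) horoSegment ≤ t}

/-- The classes `[δ]` with `d(i, δ̂ z) ≤ t`, where `δ̂` is the canonical representative. -/
def pointClasses (z : ℍ) (t : ℝ) : Set (CuspCosets Γ hT) :=
  {q | dist UpperHalfPlane.I (canonicalRep hT z q • z) ≤ t}

/-- The counting function `Π(h, z, t)`. -/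
def horoCount (z : ℍ) (t : ℝ) : ℕ := (horoClasses hT z t).ncard

/-- The counting function `Π(z, t)`. -/
def pointCount (z : ℍ) (t : ℝ) : ℕ := (pointClasses hT z t).ncard

end OrbitCount

end

noncomputable section

namespace OrbitCount

/-! No orbit point lies above height 1, so each `δ̂z` lies in the strip on or below `h`, and the
vertical geodesic gives `d(h, δ̂z) = -log Im δz =: l`. Then `(Im δz)^s = e^{-sl} = s ∫_l^∞ e^{-st}
dt`, and summing over the classes by Tonelli yields the Laplace transform of `Π(h,z,·)`
(`hasSum_exp_neg_mul_of_integrableOn`). The comparison with `Π(z,·)` holds because `i ∈ h` and every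
point of `h` is within distance 1 of `i`.

Convergence for `s > 1` follows from `Π(h,z,t) = O(e^t)` (`exists_horoCount_le`). The strip is cut
into dyadic boxes of bounded hyperbolic diameter, `O(2^k)` of them at height about `2^{-k}`. By
discreteness each box holds boundedly many orbit points, with multiplicity, and only the levels with
`2^k ≤ e^t` matter. -/

/-- Only finitely many elements of a discrete subgroup of `PSL(2, ℝ)` move `z` by at most `R`. -/
theorem finite_setOf_dist_smul_le (Γ : Subgroup PSL(2, ℝ)) [DiscreteTopology Γ] (z : ℍ) (R : ℝ) :
    {γ : Γ | dist (γ • z) z ≤ R}.Finite := by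
  -- The closed center makes `PSL(2, ℝ)` Hausdorff, and discrete subgroups of Hausdorff groups are
  -- closed.
  have hclosed : IsClosed (Γ : Set PSL(2, ℝ)) := by
    have : IsClosed ((Subgroup.center SL(2, ℝ) : Subgroup SL(2, ℝ)) : Set SL(2, ℝ)) := by
      rw [Subgroup.coe_center]
      rw [← Set.centralizer_univ]
      exact Set.isClosed_centralizer _
    exact Subgroup.isClosed_of_discrete
  -- `SL(2, ℝ)` acts properly on `ℍ`.
  have hK : IsCompact {g : SL(2, ℝ) | dist (g • z) z ≤ R} := by
    have := ProperSMul.isCompact_setOfPred_inter_nonempty (G := SL(2, ℝ)) (X := ℍ)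
      (isCompact_singleton (x := z)) (isCompact_closedBall z R)
    simpa [Set.smul_set_singleton] using this
  have hpre : IsCompact ((Subtype.val : Γ → PSL(2, ℝ)) ⁻¹'
      ((QuotientGroup.mk : SL(2, ℝ) → PSL(2, ℝ)) '' {g | dist (g • z) z ≤ R})) :=
    (hclosed.isClosedEmbedding_subtypeVal).isCompact_preimage
      (hK.image (QuotientGroup.continuous_mk (N := Subgroup.center SL(2, ℝ))))
  refine (hpre.finite DiscreteTopology.isDiscrete).subset ?_
  rintro ⟨γ, hγ⟩ h
  induction γ using QuotientGroup.induction_on with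
  | H g => exact ⟨g, h, rfl⟩

theorem dist_smul_smul_psl (g : PSL(2, ℝ)) (z w : ℍ) : dist (g • z) (g • w) = dist z w := by
  induction g using QuotientGroup.induction_on with
  | H g => exact dist_smul g z w

/-! ### Hyperbolic distance estimates -/

/-- The distance from a point of the strip below `horoSegment` to this segment. -/
theorem infDist_horoSegment {w : ℍ} (h1 : -(1 / 2) ≤ w.re) (h2 : w.re < 1 / 2) (h3 : w.im ≤ 1) :
    Metric.infDist w horoSegment = -Real.log w.im := by
  have hlog : Real.log w.im ≤ 0 := Real.log_nonpos w.im_pos.le h3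
  let v : ℍ := ⟨⟨w.re, 1⟩, one_pos⟩
  have hv : v ∈ horoSegment := ⟨h1, h2, rfl⟩
  apply le_antisymm
  · refine (Metric.infDist_le_dist_of_mem hv).trans_eq ?_
    rw [UpperHalfPlane.dist_of_re_eq (show w.re = v.re from rfl), show v.im = 1 from rfl,
      Real.log_one, Real.dist_eq, sub_zero, abs_of_nonpos hlog]
  · rw [Metric.le_infDist ⟨v, hv⟩]
    intro u hu
    refine le_trans ?_ (UpperHalfPlane.dist_log_im_le w u)
    rw [hu.2.2, Real.log_one, Real.dist_eq, sub_zero, abs_of_nonpos hlog]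

theorem I_mem_horoSegment : UpperHalfPlane.I ∈ horoSegment := by
  simp [horoSegment]

/-- A point of the strip below `horoSegment` is closer to `I` than to the segment, up to `1`. -/
theorem dist_I_le {w : ℍ} (h1 : -(1 / 2) ≤ w.re) (h2 : w.re < 1 / 2) (h3 : w.im ≤ 1) :
    dist UpperHalfPlane.I w ≤ -Real.log w.im + 1 := by
  have hlog : Real.log w.im ≤ 0 := Real.log_nonpos w.im_pos.le h3
  let v : ℍ := ⟨⟨w.re, 1⟩, one_pos⟩
  have hvw : dist v w = -Real.log w.im := by
    rw [UpperHalfPlane.dist_of_re_eq (show v.re = w.re from rfl), show v.im = 1 from rfl,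
      Real.log_one, Real.dist_eq, zero_sub, abs_neg, abs_of_nonpos hlog]
  have hIv : dist UpperHalfPlane.I v ≤ 1 := by
    refine (UpperHalfPlane.dist_le_dist_coe_div_sqrt _ _).trans ?_
    rw [show v.im = 1 from rfl, UpperHalfPlane.I_im, one_mul, Real.sqrt_one, div_one,
      Complex.dist_of_im_eq (show (UpperHalfPlane.I : ℂ).im = (v : ℂ).im by simp [v]),
      Real.dist_eq]
    have : (v : ℂ).re = w.re := rfl
    rw [this, UpperHalfPlane.coe_I, Complex.I_re, abs_le]
    constructor <;> linarith
  linarith [dist_triangle UpperHalfPlane.I v w]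

/-- Two points in a common box of a dyadic decomposition are at bounded distance. -/
theorem dist_le_three_of_box {v w : ℍ} {a : ℝ} (ha : 0 < a)
    (hre : |v.re - w.re| ≤ a) (hv : a / 2 ≤ v.im) (hv' : v.im ≤ a)
    (hw : a / 2 ≤ w.im) (hw' : w.im ≤ a) : dist v w ≤ 3 := by
  refine (UpperHalfPlane.dist_le_dist_coe_div_sqrt v w).trans ?_
  -- The constant 3 is `(a + a / 2) / (a / 2)`.
  have hs : a / 2 ≤ √(v.im * w.im) := Real.le_sqrt_of_sq_le (by nlinarith)
  rw [div_le_iff₀ (by linarith)]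
  have h : dist (v : ℂ) w ≤ |v.re - w.re| + |v.im - w.im| := by
    rw [Complex.dist_eq]
    exact Complex.norm_le_abs_re_add_abs_im _
  have him : |v.im - w.im| ≤ a / 2 := abs_le.2 ⟨by linarith, by linarith⟩
  linarith

/-! ### Counting classes -/

variable {Γ : Subgroup PSL(2, ℝ)} (hT : shift ∈ Γ)

theorem cosetIm_eq (z : ℍ) (q : CuspCosets Γ hT) :
    cosetIm hT z q = (canonicalRep hT z q • z).im := by
  rw [← cosetIm_toCoset hT, (canonicalRep_spec hT z q).1]

theorem cosetIm_pos (z : ℍ) (q : CuspCosets Γ hT) : 0 < cosetIm hT z q := by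
  rw [cosetIm_eq]
  exact UpperHalfPlane.im_pos _

theorem canonicalRep_injective (z : ℍ) : Function.Injective (canonicalRep hT z) := by
  intro p q h
  rw [← (canonicalRep_spec hT z p).1, h, (canonicalRep_spec hT z q).1]

theorem cosetIm_le_one {z : ℍ} (hzΓ : ∀ w : ℍ, 1 < w.im → w ∉ MulAction.orbit Γ z)
    (q : CuspCosets Γ hT) : cosetIm hT z q ≤ 1 := by
  rw [cosetIm_eq]
  by_contra! h
  exact hzΓ _ h (MulAction.mem_orbit _ _)

theorem horoClasses_eq {z : ℍ} (hzΓ : ∀ w : ℍ, 1 < w.im → w ∉ MulAction.orbit Γ z) (t : ℝ) :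
    horoClasses hT z t = {q | -Real.log (cosetIm hT z q) ≤ t} := by
  ext q
  have h := canonicalRep_spec hT z q
  have h1 := cosetIm_le_one hT hzΓ q
  rw [horoClasses, Set.mem_ofPred_eq, Set.mem_ofPred_eq, cosetIm_eq, infDist_horoSegment h.2.1 h.2.2]
  rwa [← cosetIm_eq]

theorem pointClasses_subset (z : ℍ) (t : ℝ) : pointClasses hT z t ⊆ horoClasses hT z t := by
  intro q hq
  refine (Metric.infDist_le_dist_of_mem I_mem_horoSegment).trans ?_
  rw [dist_comm]
  exact hq

theorem horoClasses_subset {z : ℍ} (hzΓ : ∀ w : ℍ, 1 < w.im → w ∉ MulAction.orbit Γ z) (t : ℝ) :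
    horoClasses hT z t ⊆ pointClasses hT z (t + 1) := by
  intro q hq
  rw [horoClasses_eq hT hzΓ] at hq
  have h := canonicalRep_spec hT z q
  have h1 := cosetIm_le_one hT hzΓ q
  rw [Set.mem_ofPred_eq] at hq
  rw [cosetIm_eq] at h1 hq
  exact (dist_I_le h.2.1 h.2.2 h1).trans (by linarith)

/-- The classes whose canonical representative moves `z` into a given bounded region: they are at
most as many as the elements of `Γ` moving `z` by at most the diameter of the region. -/
theorem finite_and_ncard_le_of_dist_le [DiscreteTopology Γ] (z : ℍ) (R : ℝ)
    (S : Set (CuspCosets Γ hT))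
    (hS : ∀ p ∈ S, ∀ q ∈ S, dist (canonicalRep hT z p • z) (canonicalRep hT z q • z) ≤ R) :
    S.Finite ∧ S.ncard ≤ {γ : Γ | dist (γ • z) z ≤ R}.ncard := by
  have hfin := finite_setOf_dist_smul_le Γ z R
  rcases S.eq_empty_or_nonempty with rfl | ⟨p, hp⟩
  · simp
  -- Pulling back by one fixed representative gives a bound independent of where the region lies.
  have hmaps : ∀ q ∈ S, (canonicalRep hT z p)⁻¹ * canonicalRep hT z q ∈
      {γ : Γ | dist (γ • z) z ≤ R} := by
    intro q hq
    rw [Set.mem_ofPred_eq, ← dist_smul_smul_psl (canonicalRep hT z p : PSL(2, ℝ)),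
      ← Subgroup.smul_def, ← Subgroup.smul_def, mul_smul, smul_inv_smul]
    exact hS q hq p hp
  have hinj : Set.InjOn (fun q => (canonicalRep hT z p)⁻¹ * canonicalRep hT z q) S :=
    fun q _ q' _ h => canonicalRep_injective hT z (mul_left_cancel h)
  exact ⟨Set.Finite.of_injOn hmaps hinj hfin, Set.ncard_le_ncard_of_injOn _ hmaps hinj hfin⟩

/-- The classes `[δ]` with `Im (δ z)` in the dyadic interval of index `k`, and with real part in
the `j`-th subinterval. -/
def dyadicBox (z : ℍ) (k : ℕ) (j : ℤ) : Set (CuspCosets Γ hT) :=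
  {q | 1 / 2 ^ (k + 1) < cosetIm hT z q ∧ cosetIm hT z q ≤ 1 / 2 ^ k ∧
    ⌊(canonicalRep hT z q • z).re * 2 ^ k⌋ = j}

theorem finite_and_ncard_dyadicBox_le [DiscreteTopology Γ] (z : ℍ) (k : ℕ) (j : ℤ) :
    (dyadicBox hT z k j).Finite ∧
      (dyadicBox hT z k j).ncard ≤ {γ : Γ | dist (γ • z) z ≤ 3}.ncard := by
  apply finite_and_ncard_le_of_dist_le
  rintro p ⟨hp1, hp2, hp3⟩ q ⟨hq1, hq2, hq3⟩
  rw [cosetIm_eq] at hp1 hp2 hq1 hq2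
  have h2 : (1 : ℝ) / 2 ^ (k + 1) = 1 / 2 ^ k / 2 := by
    rw [pow_succ]
    field_simp
  rw [h2] at hp1 hq1
  refine dist_le_three_of_box (a := 1 / 2 ^ k) (by positivity) ?_ hp1.le hp2 hq1.le hq2
  have := Int.abs_sub_lt_one_of_floor_eq_floor (hp3.trans hq3.symm)
  rw [← sub_mul, abs_mul, abs_of_pos (show (0 : ℝ) < 2 ^ k by positivity)] at this
  rw [le_div_iff₀ (by positivity)]
  exact this.le

/-- The range of `j` is twice what `|Re| ≤ 1/2` requires for large `k`; this keeps its endpoints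
integral at `k = 0`. -/
theorem horoClasses_subset_iUnion {z : ℍ}
    (hzΓ : ∀ w : ℍ, 1 < w.im → w ∉ MulAction.orbit Γ z) {t : ℝ} {K : ℕ}
    (hK : Real.exp t < 2 ^ (K + 1)) :
    horoClasses hT z t ⊆ ⋃ x ∈ (Finset.range (K + 1)).sigma
      (fun k => Finset.Ico (-2 ^ k : ℤ) (2 ^ k)), dyadicBox hT z x.1 x.2 := by
  intro q hq
  rw [horoClasses_eq hT hzΓ, Set.mem_ofPred_eq] at hq
  have hpos := cosetIm_pos hT z q
  obtain ⟨k, hk1, hk2⟩ := exists_nat_pow_near_of_lt_one hpos (cosetIm_le_one hT hzΓ q)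
    (show (0 : ℝ) < 1 / 2 by norm_num) (by norm_num)
  rw [one_div_pow] at hk1 hk2
  have hkK : k < K + 1 := by
    have h1 : (cosetIm hT z q)⁻¹ ≤ Real.exp t := by
      rw [← Real.exp_log (inv_pos.2 hpos), Real.log_inv]
      exact Real.exp_le_exp.2 hq
    have h2 : (2 : ℝ) ^ k ≤ (cosetIm hT z q)⁻¹ := by
      rw [le_inv_comm₀ (by positivity) hpos, ← one_div]
      exact hk2
    exact (pow_lt_pow_iff_right₀ (one_lt_two (α := ℝ))).1 ((h2.trans h1).trans_lt hK)
  have hs := canonicalRep_spec hT z q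
  have h2k : (0 : ℝ) < 2 ^ k := by positivity
  simp only [Set.mem_iUnion]
  refine ⟨⟨k, ⌊(canonicalRep hT z q • z).re * 2 ^ k⌋⟩, ?_, hk1, hk2, rfl⟩
  rw [Finset.mem_sigma, Finset.mem_range, Finset.mem_Ico, Int.le_floor, Int.floor_lt]
  push_cast
  exact ⟨hkK, by nlinarith [hs.2.1], by nlinarith [hs.2.2]⟩

theorem finite_horoClasses [DiscreteTopology Γ] {z : ℍ}
    (hzΓ : ∀ w : ℍ, 1 < w.im → w ∉ MulAction.orbit Γ z) (t : ℝ) :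
    (horoClasses hT z t).Finite := by
  obtain ⟨K, hK⟩ := pow_unbounded_of_one_lt (Real.exp t) (one_lt_two (α := ℝ))
  refine Set.Finite.subset ?_ (horoClasses_subset_iUnion hT hzΓ (K := K)
    (hK.trans (pow_lt_pow_right₀ one_lt_two (Nat.lt_succ_self K))))
  exact Set.Finite.biUnion (Finset.finite_toSet _)
    fun x _ => (finite_and_ncard_dyadicBox_le hT z x.1 x.2).1

/-- The counting function grows at most like `exp t`. -/
theorem exists_horoCount_le [DiscreteTopology Γ] {z : ℍ}
    (hzΓ : ∀ w : ℍ, 1 < w.im → w ∉ MulAction.orbit Γ z) :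
    ∃ C : ℝ, ∀ t, 0 ≤ t → (horoCount hT z t : ℝ) ≤ C * Real.exp t := by
  refine ⟨4 * {γ : Γ | dist (γ • z) z ≤ 3}.ncard, fun t ht => ?_⟩
  obtain ⟨K, hK1, hK2⟩ := exists_nat_pow_near (Real.one_le_exp ht) (one_lt_two (α := ℝ))
  set m := {γ : Γ | dist (γ • z) z ≤ 3}.ncard
  -- The sum of `2 * 2 ^ k` over `k ≤ K` is below `4 * 2 ^ K`, and `2 ^ K ≤ exp t`.
  have hcard : ((Finset.range (K + 1)).sigma
      (fun k => Finset.Ico (-2 ^ k : ℤ) (2 ^ k))).card ≤ 4 * 2 ^ K := by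
    rw [Finset.card_sigma]
    have : ∀ k ∈ Finset.range (K + 1), (Finset.Ico (-2 ^ k : ℤ) (2 ^ k)).card = 2 * 2 ^ k := by
      intro k _
      rw [Int.card_Ico, sub_neg_eq_add, ← two_mul]
      exact_mod_cast Int.toNat_natCast (2 * 2 ^ k)
    rw [Finset.sum_congr rfl this, ← Finset.mul_sum, Nat.geomSum_eq le_rfl, pow_succ]
    omega
  have h : horoCount hT z t ≤ 4 * 2 ^ K * m := by
    refine (Set.ncard_le_ncard (horoClasses_subset_iUnion hT hzΓ hK2)
      (Set.Finite.biUnion (Finset.finite_toSet _)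
        fun x _ => (finite_and_ncard_dyadicBox_le hT z x.1 x.2).1)).trans ?_
    refine (Finset.set_ncard_biUnion_le _ _).trans ?_
    refine (Finset.sum_le_card_nsmul _ _ m
      fun x _ => (finite_and_ncard_dyadicBox_le hT z x.1 x.2).2).trans ?_
    exact Nat.mul_le_mul_right m hcard
  calc (horoCount hT z t : ℝ) ≤ 4 * 2 ^ K * m := by exact_mod_cast h
    _ = 4 * m * 2 ^ K := by ring
    _ ≤ 4 * m * Real.exp t := by gcongr

end OrbitCount

end

/-! ### Laplace transforms of counting functions -/

noncomputable section

open MeasureTheory Set in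
theorem lintegral_indicator_Ici_exp {s a : ℝ} (hs : 0 < s) (ha : 0 ≤ a) :
    ∫⁻ t in Ioi (0 : ℝ), (Ici a).indicator (fun t => ENNReal.ofReal (s * Real.exp (-s * t))) t =
      ENNReal.ofReal (Real.exp (-s * a)) := by
  rw [lintegral_indicator measurableSet_Ici, Measure.restrict_restrict measurableSet_Ici]
  -- For `a = 0` the intersection is `Ioi 0`, otherwise `Ici a`.
  have hae : (Ici a ∩ Ioi 0 : Set ℝ) =ᵐ[volume] Ioi a := by
    rcases ha.eq_or_lt with rfl | h
    · exact (inter_eq_right.2 Ioi_subset_Ici_self).eventuallyEq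
    · rw [inter_eq_left.2 (Ici_subset_Ioi.2 h)]
      exact Ioi_ae_eq_Ici.symm
  rw [Measure.restrict_congr_set hae, ← ofReal_integral_eq_lintegral_ofReal
    ((integrableOn_exp_mul_Ioi (neg_lt_zero.2 hs) a).const_mul s)
    (Filter.Eventually.of_forall fun t => by positivity), integral_const_mul,
    integral_exp_mul_Ioi (neg_lt_zero.2 hs)]
  congr 1
  field_simp

open MeasureTheory Set in
/-- A Dirichlet series as the Laplace transform of its counting function. -/
theorem hasSum_exp_neg_mul_of_integrableOn {β : Type*} {l : β → ℝ} (hl : ∀ q, 0 ≤ l q)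
    (hfin : ∀ t, {q | l q ≤ t}.Finite) {s : ℝ} (hs : 0 < s)
    (hint : IntegrableOn (fun t : ℝ => Real.exp (-s * t) * ({q | l q ≤ t}.ncard : ℝ)) (Ioi 0)) :
    HasSum (fun q => Real.exp (-s * l q))
      (s * ∫ t in Ioi (0 : ℝ), Real.exp (-s * t) * ({q | l q ≤ t}.ncard : ℝ)) := by
  -- Tonelli for sums, `lintegral_tsum`, requires a countable index.
  have hcount : Countable β := by
    rw [← Set.countable_univ_iff]
    refine (countable_iUnion fun n : ℕ => (hfin n).countable).mono fun q _ => ?_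
    obtain ⟨n, hn⟩ := exists_nat_ge (l q)
    exact mem_iUnion.2 ⟨n, hn⟩
  have hterm : ∀ t : ℝ, ∑' q, (Ici (l q)).indicator
      (fun t => ENNReal.ofReal (s * Real.exp (-s * t))) t =
      ENNReal.ofReal (s * (Real.exp (-s * t) * ({q | l q ≤ t}.ncard : ℝ))) := by
    intro t
    have h : ∀ q, (Ici (l q)).indicator (fun t => ENNReal.ofReal (s * Real.exp (-s * t))) t =
        {q | l q ≤ t}.indicator (fun _ => ENNReal.ofReal (s * Real.exp (-s * t))) q := fun q => by
      simp [indicator_apply]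
    simp_rw [h]
    rw [← tsum_subtype, ENNReal.tsum_set_const, ← (hfin t).cast_ncard_eq, ← mul_assoc,
      ENNReal.ofReal_mul (p := s * Real.exp (-s * t)) (by positivity), ENNReal.ofReal_natCast,
      mul_comm]
    rfl
  have htsum : ∑' q, ENNReal.ofReal (Real.exp (-s * l q)) =
      ENNReal.ofReal (s * ∫ t in Ioi (0 : ℝ),
        Real.exp (-s * t) * ({q | l q ≤ t}.ncard : ℝ)) := by
    simp_rw [← fun q => lintegral_indicator_Ici_exp hs (hl q)]
    rw [← lintegral_tsum fun q => (Measurable.indicator (by fun_prop)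
      measurableSet_Ici).aemeasurable]
    simp_rw [hterm]
    rw [← ofReal_integral_eq_lintegral_ofReal (hint.const_mul s)
      (Filter.Eventually.of_forall fun t => by positivity), integral_const_mul]
  -- Integrability makes the `ENNReal` sum finite, which yields real summability.
  have := ENNReal.hasSum_toReal (htsum ▸ ENNReal.ofReal_ne_top)
  rw [← ENNReal.tsum_toReal_eq fun _ => ENNReal.ofReal_ne_top, htsum] at this
  simpa only [ENNReal.toReal_ofReal (Real.exp_pos _).le, ENNReal.toReal_ofReal
    (mul_nonneg hs.le (setIntegral_nonneg measurableSet_Ioi fun t _ =>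
      mul_nonneg (Real.exp_pos _).le (Nat.cast_nonneg _)))] using this

open MeasureTheory Set in
/-- The Laplace transform of a monotone counting function of exponential growth rate `1` converges
to the right of `1`. -/
theorem integrableOn_exp_neg_mul_of_le {N : ℝ → ℕ} (hN : Monotone N) {C s : ℝ} (hs : 1 < s)
    (hC : ∀ t, 0 ≤ t → (N t : ℝ) ≤ C * Real.exp t) :
    IntegrableOn (fun t : ℝ => Real.exp (-s * t) * (N t : ℝ)) (Ioi 0) := by
  refine Integrable.mono' ((integrableOn_exp_mul_Ioi (show 1 - s < 0 by linarith) 0).const_mul C)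
    ?_ ?_
  · have : Measurable fun t => (N t : ℝ) := (Nat.mono_cast.comp hN).measurable
    exact (Measurable.mul (by fun_prop) this).aestronglyMeasurable
  · refine (ae_restrict_mem measurableSet_Ioi).mono fun t ht => ?_
    rw [Real.norm_of_nonneg (by positivity)]
    calc Real.exp (-s * t) * (N t : ℝ) ≤ Real.exp (-s * t) * (C * Real.exp t) := by
          gcongr
          exact hC t (le_of_lt ht)
      _ = C * Real.exp ((1 - s) * t) := by
          rw [mul_left_comm, ← Real.exp_add]
          ring_nf

end

open OrbitCount MeasureTheory in
theorem proposition2p2 (Γ : Subgroup PSL(2, ℝ)) [DiscreteTopology Γ]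
    (hT : OrbitCount.shift ∈ Γ) (s : ℝ) (hs : 1 < s) (z : ℍ) (hz : z.im < 1)
    (hzΓ : ∀ w : ℍ, 1 < w.im → w ∉ MulAction.orbit Γ z) :
    -- the counting functions count finite sets, and they are comparable
    (∀ t : ℝ, (OrbitCount.horoClasses hT z t).Finite ∧ (OrbitCount.pointClasses hT z t).Finite) ∧
    (∀ t : ℝ, OrbitCount.pointCount hT z t ≤ OrbitCount.horoCount hT z t ∧
      OrbitCount.horoCount hT z t ≤ OrbitCount.pointCount hT z (t + 1)) ∧
    -- the series and the three integrals converge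
    Summable (fun q : OrbitCount.CuspCosets Γ hT =>
      (OrbitCount.cosetIm hT z q : ℂ) ^ (s : ℂ)) ∧
    MeasureTheory.IntegrableOn
      (fun t : ℝ => Real.exp (-s * t) * (OrbitCount.horoCount hT z t : ℝ)) (Set.Ioi 0) ∧
    MeasureTheory.IntegrableOn
      (fun t : ℝ => Real.exp (-s * t) * (OrbitCount.pointCount hT z t : ℝ)) (Set.Ioi 0) ∧
    MeasureTheory.IntegrableOn
      (fun t : ℝ => Real.exp (-s * t) * (OrbitCount.pointCount hT z (t + 1) : ℝ)) (Set.Ioi 0) ∧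
    -- the Eisenstein series as a Laplace transform
    OrbitCount.eisenstein hT z s =
      ((s * ∫ t in Set.Ioi (0 : ℝ),
        Real.exp (-s * t) * (OrbitCount.horoCount hT z t : ℝ) : ℝ) : ℂ) ∧
    -- the two bounds for the (real) value of the Eisenstein series
    s * (∫ t in Set.Ioi (0 : ℝ), Real.exp (-s * t) * (OrbitCount.pointCount hT z t : ℝ)) ≤
      (OrbitCount.eisenstein hT z s).re ∧
    (OrbitCount.eisenstein hT z s).re ≤
      s * ∫ t in Set.Ioi (0 : ℝ),
        Real.exp (-s * t) * (OrbitCount.pointCount hT z (t + 1) : ℝ) := by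
  have hfin : ∀ t, (horoClasses hT z t).Finite := finite_horoClasses hT hzΓ
  have hfin' : ∀ t, (pointClasses hT z t).Finite :=
    fun t => (hfin t).subset (pointClasses_subset hT z t)
  have hle : ∀ t, pointCount hT z t ≤ horoCount hT z t :=
    fun t => Set.ncard_le_ncard (pointClasses_subset hT z t) (hfin t)
  have hle' : ∀ t, horoCount hT z t ≤ pointCount hT z (t + 1) :=
    fun t => Set.ncard_le_ncard (horoClasses_subset hT hzΓ t) (hfin' _)
  have hmono : Monotone (horoCount hT z) :=
    fun a b hab => Set.ncard_le_ncard (fun q hq => le_trans hq hab) (hfin b)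
  have hmono' : Monotone (pointCount hT z) :=
    fun a b hab => Set.ncard_le_ncard (fun q hq => le_trans hq hab) (hfin' b)
  obtain ⟨C, hC⟩ := exists_horoCount_le hT hzΓ
  have hint := integrableOn_exp_neg_mul_of_le hmono hs hC
  have hint1 := integrableOn_exp_neg_mul_of_le hmono' hs
    fun t ht => (Nat.cast_le.2 (hle t)).trans (hC t ht)
  -- The factor `exp 1` absorbs the shift of `t` by 1.
  have hint2 := integrableOn_exp_neg_mul_of_le (N := fun t => pointCount hT z (t + 1))
    (fun a b hab => hmono' (by linarith)) (C := C * Real.exp 1) hs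
    fun t ht => by
      rw [mul_assoc, ← Real.exp_add, add_comm 1]
      exact (Nat.cast_le.2 (hle _)).trans (hC _ (by linarith))
  have hs0 : 0 < s := by linarith
  have hcount : ∀ t, {q | -Real.log (cosetIm hT z q) ≤ t}.ncard = horoCount hT z t :=
    fun t => by rw [horoCount, horoClasses_eq hT hzΓ]
  have hsum := hasSum_exp_neg_mul_of_integrableOn (l := fun q => -Real.log (cosetIm hT z q))
    (fun q => neg_nonneg.2 (Real.log_nonpos (cosetIm_pos hT z q).le (cosetIm_le_one hT hzΓ q)))
    (fun t => by rw [← horoClasses_eq hT hzΓ]; exact hfin t) hs0 (by simpa only [hcount] using hint)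
  simp only [hcount] at hsum
  have hterm : ∀ q, ((Real.exp (-s * -Real.log (cosetIm hT z q)) : ℝ) : ℂ) =
      (cosetIm hT z q : ℂ) ^ (s : ℂ) := fun q => by
    rw [← Complex.ofReal_cpow (cosetIm_pos hT z q).le, Real.rpow_def_of_pos (cosetIm_pos hT z q)]
    ring_nf
  have hsumC := Complex.hasSum_ofReal.2 hsum
  simp only [hterm] at hsumC
  have heis : eisenstein hT z s = _ := hsumC.tsum_eq
  refine ⟨fun t => ⟨hfin t, hfin' t⟩, fun t => ⟨hle t, hle' t⟩, hsumC.summable, hint, hint1, hint2,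
    heis, ?_, ?_⟩ <;> rw [heis, Complex.ofReal_re] <;>
  refine mul_le_mul_of_nonneg_left (integral_mono (by assumption) (by assumption) fun t => ?_)
    hs0.le
  · exact mul_le_mul_of_nonneg_left (Nat.cast_le.2 (hle t)) (Real.exp_pos _).le
  · exact mul_le_mul_of_nonneg_left (Nat.cast_le.2 (hle' t)) (Real.exp_pos _).le
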